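/- Let $H$ be a real or complex Hilbert space, let $D\subseteq H$ be a linear subspace (with the norm of $H$), let $\mathcal T: H\to D$ be a bounded linear bijection, and let $\mathcal A\in\mathcal L(H)$ be a bounded linear operator. Define $A:=\mathcal A\circ\mathcal T^{-1}: D\to H$. A $C_0$-semigroup on $H$ is a family $(S(t))_{t\ge 0}$ in $\mathcal L(H)$ with $S(0)=I$, $S(t+s)=S(t)S(s)$ for all $t,s\ge 0$, and $\lim_{t\to0^+}S(t)x=x$ for all $x\in H$. It is a quasicontraction semigroup with rate $\omega\in\mathbb R$ if moreover $\|S(t)\|\le e^{\omega t}$ for all $t\ge 0$. The operator $A:D\to H$ is its infinitesimal generator if $D$ is exactly the set of all $x\in H$ for which $\lim_{t\to0^+}\frac1t(S(t)x-x)$ exists, and $Ax$ equals this limit for every $x\in D$. Then for every $\omega\in\mathbb R$, the operator $A$ is the infinitesimal generator of a quasicontraction semigroup with rate $\omega$ on $H$ if and only if both of the following conditions hold: 1. $\operatorname{Re}\langle \mathcal Tv,\mathcal Av\rangle\le\omega\langle\mathcal Tv,\mathcal Tv\rangle$ for all $v\in H$ (if $H$ is real, the real part is redundant); 2. there exist real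 numbers $\varepsilon>0$ and $\lambda>\omega$ such that $\|(\lambda\mathcal T^*-\mathcal A^*)v\|\ge\varepsilon\|v\|$ for all $v\in H$. Here $\mathcal T^*,\mathcal A^*\in\mathcal L(H)$ are the Hilbert space adjoints, with $\mathcal T$ regarded as an operator from $H$ into $H$. -/

import Mathlib

open Filter Topology

section Semigroups

variable {𝕜 H : Type*} [RCLike 𝕜] [NormedAddCommGroup H] [InnerProductSpace 𝕜 H]

/-- `(S t)_{t ≥ 0}` is a strongly continuous semigroup of bounded linear operators on `H`.
Only the values `S t` with `t ≥ 0` matter. -/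
structure IsC0Semigroup (S : ℝ → H →L[𝕜] H) : Prop where
  zero : S 0 = ContinuousLinearMap.id 𝕜 H
  add : ∀ t s : ℝ, 0 ≤ t → 0 ≤ s → S (t + s) = S t ∘L S s
  tendsto_zero : ∀ x : H, Tendsto (fun t : ℝ => S t x) (𝓝[>] 0) (𝓝 x)

/-- A quasicontraction semigroup with rate `ω`: a strongly continuous semigroup with
`‖S t‖ ≤ exp (ω t)` for all `t ≥ 0`. -/
structure IsQuasicontractionSemigroup (ω : ℝ) (S : ℝ → H →L[𝕜] H) : Prop
    extends IsC0Semigroup S where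
  norm_le : ∀ t : ℝ, 0 ≤ t → ‖S t‖ ≤ Real.exp (ω * t)

/-- The difference quotient `t⁻¹ (S t x - x)`. -/
noncomputable def diffQuot (S : ℝ → H →L[𝕜] H) (x : H) (t : ℝ) : H :=
  ((t⁻¹ : ℝ) : 𝕜) • (S t x - x)

/-- The (possibly unbounded) operator `A`, with domain `A.domain`, is the infinitesimal generator
of `S`: on its domain it is the limit of the difference quotients as `t → 0⁺`, and its domain
contains every `x` for which this limit exists. -/
structure IsInfinitesimalGenerator (A : H →ₗ.[𝕜] H) (S : ℝ → H →L[𝕜] H) : Prop where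
  tendsto : ∀ x : A.domain, Tendsto (diffQuot S (x : H)) (𝓝[>] 0) (𝓝 (A x))
  mem_domain : ∀ x : H, (∃ y : H, Tendsto (diffQuot S x) (𝓝[>] 0) (𝓝 y)) → x ∈ A.domain

/-- `A` is the infinitesimal generator of a quasicontraction semigroup on `H` with rate `ω`. -/
def GeneratesQuasicontraction (ω : ℝ) (A : H →ₗ.[𝕜] H) : Prop :=
  ∃ S : ℝ → H →L[𝕜] H, IsQuasicontractionSemigroup ω S ∧ IsInfinitesimalGenerator A S

/-- The operator `𝒜 ∘ T⁻¹ : D → H`, as an operator in `H` with domain `D`, for a bounded linear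
bijection `T` from `H` onto the subspace `D` of `H`. -/
noncomputable def compInverse {D : Submodule 𝕜 H} (T : H →L[𝕜] D) (hT : Function.Bijective T)
    (𝒜 : H →L[𝕜] H) : H →ₗ.[𝕜] H where
  domain := D
  toFun := (𝒜 : H →ₗ[𝕜] H) ∘ₗ
    ((LinearEquiv.ofBijective (T : H →ₗ[𝕜] D) hT).symm : D →ₗ[𝕜] H)

end Semigroups

/-! With `x = T v`, condition 1 says that `A - ω` is dissipative. Since `(l - A) T = l T - 𝒜` and
`T` is onto `D`, condition 2 says that `l - A` maps `D` onto `H`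
(`surjective_iff_adjoint_bounded_below`). After the rescaling `exp (-ω t) S t`, the theorem is thus
Lumer–Phillips for `A - ω`.

Sufficiency (`IsDissipative.generatesQuasicontraction`): the Yosida approximations are bounded,
commuting and dissipative and converge to the operator on its domain, so their exponentials converge
to the semigroup. Density of `D` is not assumed; it follows from dissipativity and the range
condition.

Necessity: dissipativity comes from differentiating at `0`. For the range no Laplace transform is
used: at negative rate `1 - S 1` is invertible, and the generator maps `∫₀¹ S s z ds` to `S 1 z -
z`, so it is onto. -/

/-! ### Exponentials of bounded dissipative operators. -/

section BoundedExponential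

variable {𝕜 H : Type*} [RCLike 𝕜] [NormedAddCommGroup H] [InnerProductSpace 𝕜 H]

/-- The operator exponential `exp (t B)` of a bounded operator, for real `t`. -/
noncomputable def opExp (B : H →L[𝕜] H) (t : ℝ) : H →L[𝕜] H :=
  NormedSpace.exp ((t : 𝕜) • B)

theorem opExp_zero (B : H →L[𝕜] H) : opExp B 0 = 1 := by
  simp [opExp]

theorem commute_opExp_right {B C : H →L[𝕜] H} (h : Commute B C) (t : ℝ) :
    Commute B (opExp C t) :=
  (h.smul_right (t : 𝕜)).exp_right

variable [CompleteSpace H]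

theorem opExp_add (B : H →L[𝕜] H) (t s : ℝ) : opExp B (t + s) = opExp B t * opExp B s := by
  let _ : NormedAlgebra ℚ (H →L[𝕜] H) := NormedAlgebra.restrictScalars ℚ 𝕜 _
  have h : Commute ((t : 𝕜) • B) ((s : 𝕜) • B) :=
    ((Commute.refl B).smul_left _).smul_right _
  rw [opExp, opExp, opExp, ← NormedSpace.exp_add_of_commute h, ← add_smul, RCLike.ofReal_add]

variable [NormedSpace ℝ H] [IsScalarTower ℝ 𝕜 H]

theorem hasDerivAt_opExp_apply (B : H →L[𝕜] H) (x : H) (t : ℝ) :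
    HasDerivAt (fun s => opExp B s x) (opExp B t (B x)) t := by
  have h1 : HasDerivAt (fun u : 𝕜 => NormedSpace.exp (u • B) x)
      (NormedSpace.exp ((t : 𝕜) • B) (B x)) (t : 𝕜) := by
    have := (hasDerivAt_exp_smul_const B (t : 𝕜)).clm_apply (hasDerivAt_const (t : 𝕜) x)
    simpa using this
  have h2 : HasDerivAt (fun s : ℝ => (s : 𝕜)) 1 t := by
    simpa using (RCLike.ofRealCLM (K := 𝕜)).hasDerivAt (x := t)
  simpa [Function.comp_def, opExp] using HasDerivAt.scomp t h1 h2

/-- With `u = exp (s B) x`, the derivative of `‖u‖²` is `2 Re ⟨u, B u⟩ ≤ 0`. -/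
theorem norm_opExp_apply_le {B : H →L[𝕜] H} (hB : ∀ x, RCLike.re (inner 𝕜 x (B x)) ≤ 0)
    {t : ℝ} (ht : 0 ≤ t) (x : H) : ‖opExp B t x‖ ≤ ‖x‖ := by
  have hd : ∀ s, HasDerivAt (fun s => RCLike.re (inner 𝕜 (opExp B s x) (opExp B s x)))
      (RCLike.re (inner 𝕜 (opExp B s x) (opExp B s (B x))
        + inner 𝕜 (opExp B s (B x)) (opExp B s x))) s := fun s => by
    have h := (hasDerivAt_opExp_apply B x s).inner 𝕜 (hasDerivAt_opExp_apply B x s)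
    exact (RCLike.reCLM (K := 𝕜)).hasFDerivAt.comp_hasDerivAt s h
  have hanti : Antitone (fun s => RCLike.re (inner 𝕜 (opExp B s x) (opExp B s x))) := by
    refine antitone_of_hasDerivAt_nonpos hd fun s => ?_
    have hc : opExp B s (B x) = B (opExp B s x) :=
      congrArg (fun L : H →L[𝕜] H => L x) (commute_opExp_right (Commute.refl B) s).symm.eq
    rw [map_add, inner_re_symm (𝕜 := 𝕜) (opExp B s (B x)), hc]
    have := hB (opExp B s x)
    simp only [Pi.zero_apply]
    linarith
  have := hanti ht
  simp only [opExp_zero, one_apply_eq_self, inner_self_eq_norm_sq] at this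
  exact (sq_le_sq₀ (norm_nonneg _) (norm_nonneg _)).mp this

theorem norm_opExp_sub_opExp_apply_le {B C : H →L[𝕜] H} (hBC : Commute B C)
    (hB : ∀ x, RCLike.re (inner 𝕜 x (B x)) ≤ 0) (hC : ∀ x, RCLike.re (inner 𝕜 x (C x)) ≤ 0)
    {t : ℝ} (ht : 0 ≤ t) (x : H) :
    ‖opExp B t x - opExp C t x‖ ≤ t * ‖B x - C x‖ := by
  -- Along the segment, `s ↦ exp ((t - s) C) exp (s B) x` has derivative
  -- `exp ((t - s) C) exp (s B) (B - C) x`.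
  have hE : ∀ s : ℝ, opExp C (t - s) * opExp B s = opExp C t * opExp (B - C) s := fun s => by
    rw [sub_eq_add_neg, opExp_add, mul_assoc]
    congr 1
    let _ : NormedAlgebra ℚ (H →L[𝕜] H) := NormedAlgebra.restrictScalars ℚ 𝕜 _
    have h : Commute (((-s : ℝ) : 𝕜) • C) ((s : 𝕜) • B) :=
      (hBC.symm.smul_left _).smul_right _
    rw [opExp, opExp, opExp, ← NormedSpace.exp_add_of_commute h]
    congr 1
    push_cast
    module
  have hd : ∀ s ∈ Set.Icc (0 : ℝ) t, HasDerivWithinAt (fun s => opExp C t (opExp (B - C) s x))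
      (opExp C t (opExp (B - C) s (B x - C x))) (Set.Icc 0 t) s := fun s _ => by
    have h := ((opExp C t).restrictScalars ℝ).hasFDerivAt.comp_hasDerivAt s
      (hasDerivAt_opExp_apply (B - C) x s)
    exact h.hasDerivWithinAt
  have hb : ∀ s ∈ Set.Ico (0 : ℝ) t, ‖opExp C t (opExp (B - C) s (B x - C x))‖
      ≤ ‖B x - C x‖ := fun s hs => by
    have := congrArg (fun L : H →L[𝕜] H => L (B x - C x)) (hE s)
    simp only [mul_apply_eq_comp] at this
    rw [← this]
    exact (norm_opExp_apply_le hC (sub_nonneg.2 hs.2.le) _).trans (norm_opExp_apply_le hB hs.1 _)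
  have h := norm_image_sub_le_of_norm_deriv_le_segment' hd hb t ⟨ht, le_rfl⟩
  have h1 := congrArg (fun L : H →L[𝕜] H => L x) (hE t)
  simp only [mul_apply_eq_comp, sub_self, opExp_zero,
    one_apply_eq_self] at h1
  simp only [opExp_zero, one_apply_eq_self, ← h1, sub_zero] at h
  linarith

end BoundedExponential

/-! ### Semigroups as strong limits of exponentials. -/

section YosidaApproximation

variable {𝕜 H : Type*} [RCLike 𝕜] [NormedAddCommGroup H] [InnerProductSpace 𝕜 H]

theorem tendsto_apply_zero_of_dense {ι : Type*} {l : Filter ι} {L : ι → H →L[𝕜] H} {C : ℝ}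
    (hL : ∀ᶠ i in l, ∀ x, ‖L i x‖ ≤ C * ‖x‖) {s : Set H} (hs : Dense s)
    (h : ∀ x ∈ s, Tendsto (fun i => L i x) l (𝓝 0)) (x : H) :
    Tendsto (fun i => L i x) l (𝓝 0) := by
  rw [Metric.tendsto_nhds]
  intro ε hε
  obtain ⟨y, hy, hxy⟩ := Metric.dense_iff.1 hs x (ε / (2 * (|C| + 1))) (by positivity)
  rw [Metric.mem_ball, dist_comm, dist_eq_norm, lt_div_iff₀ (by positivity)] at hy
  filter_upwards [hL, Metric.tendsto_nhds.1 (h y hxy) (ε / 2) (by positivity)] with i hi hi'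
  rw [dist_zero_right] at hi' ⊢
  have h1 : L i x = L i (x - y) + L i y := by simp
  have h2 : C * ‖x - y‖ ≤ (|C| + 1) * ‖x - y‖ := by
    gcongr
    linarith [le_abs_self C]
  rw [h1]
  have := norm_add_le (L i (x - y)) (L i y)
  linarith [hi (x - y)]

variable [CompleteSpace H]

/-- Commuting bounded dissipative operators converging strongly on a dense set have convergent
exponentials. -/
theorem exists_contractionSemigroup_of_tendsto {Y : ℕ → H →L[𝕜] H}
    (hcomm : ∀ m n, Commute (Y m) (Y n)) (hY : ∀ n x, RCLike.re (inner 𝕜 x (Y n x)) ≤ 0)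
    {s : Set H} (hs : Dense s) {a : H → H}
    (ha : ∀ x ∈ s, Tendsto (fun n => Y n x) atTop (𝓝 (a x))) :
    ∃ S : ℝ → H →L[𝕜] H, IsQuasicontractionSemigroup 0 S ∧
      ∀ x ∈ s, Tendsto (diffQuot S x) (𝓝[>] 0) (𝓝 (a x)) := by
  let _ : NormedSpace ℝ H := NormedSpace.restrictScalars ℝ 𝕜 H
  have _ : IsScalarTower ℝ 𝕜 H := RestrictScalars.isScalarTower ℝ 𝕜 H
  have hcauchy : ∀ t : ℝ, 0 ≤ t → ∀ x, CauchySeq (fun n => opExp (Y n) t x) := by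
    intro t ht x
    rw [cauchySeq_iff_tendsto_dist_atTop_0]
    have key := tendsto_apply_zero_of_dense (l := (atTop : Filter (ℕ × ℕ)))
      (L := fun p => opExp (Y p.1) t - opExp (Y p.2) t) (C := 2) (s := s)
      (Eventually.of_forall fun p y => by
        have h1 := norm_opExp_apply_le (hY p.1) ht y
        have h2 := norm_opExp_apply_le (hY p.2) ht y
        have h3 := norm_sub_le (opExp (Y p.1) t y) (opExp (Y p.2) t y)
        rw [sub_apply]
        linarith) hs (fun y hy => by
        have hc := cauchySeq_iff_tendsto_dist_atTop_0.1 (ha y hy).cauchySeq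
        have hc' := hc.const_mul t
        rw [mul_zero] at hc'
        refine squeeze_zero_norm (fun p => ?_) hc'
        rw [dist_eq_norm, sub_apply]
        exact norm_opExp_sub_opExp_apply_le (hcomm _ _) (hY _) (hY _) ht y) x
    simpa [dist_eq_norm] using key.norm
  choose! f hf using fun t ht x => cauchySeq_tendsto_of_complete (hcauchy t ht x)
  have hmax : ∀ t : ℝ, (0 : ℝ) ≤ max t 0 := fun t => le_max_right _ _
  -- The limit is known only for `t ≥ 0`; negative times get the value at `0`.
  let S : ℝ → H →L[𝕜] H := fun t => continuousLinearMapOfTendsto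
    (fun n => opExp (Y n) (max t 0)) (tendsto_pi_nhds.2 fun x => hf _ (hmax t) x)
  have hS : ∀ t : ℝ, 0 ≤ t → ∀ x, Tendsto (fun n => opExp (Y n) t x) atTop (𝓝 (S t x)) := by
    intro t ht x
    have := hf _ (hmax t) x
    change Tendsto _ _ (𝓝 (f (max t 0) x))
    simpa only [max_eq_left ht] using this
  have hnorm : ∀ t : ℝ, 0 ≤ t → ∀ x, ‖S t x‖ ≤ ‖x‖ := fun t ht x =>
    le_of_tendsto (hS t ht x).norm (Eventually.of_forall fun n => norm_opExp_apply_le (hY n) ht x)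
  -- The factor `t` cancels the `t⁻¹` of the difference quotient, so one fixed `n` serves for all
  -- small `t`.
  have happrox : ∀ t : ℝ, 0 ≤ t → ∀ x ∈ s, ∀ n,
      ‖opExp (Y n) t x - S t x‖ ≤ t * ‖Y n x - a x‖ := fun t ht x hx n =>
    le_of_tendsto_of_tendsto' (tendsto_const_nhds.sub (hS t ht x)).norm
      ((tendsto_const_nhds.sub (ha x hx)).norm.const_mul t)
      fun m => norm_opExp_sub_opExp_apply_le (hcomm n m) (hY n) (hY m) ht x
  have hdiff : ∀ x ∈ s, Tendsto (diffQuot S x) (𝓝[>] 0) (𝓝 (a x)) := by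
    intro x hx
    rw [Metric.tendsto_nhds]
    intro ε hε
    obtain ⟨n, hn⟩ := (Metric.tendsto_nhds.1 (ha x hx) (ε / 3) (by positivity)).exists
    have hder := (hasDerivAt_opExp_apply (Y n) x 0).tendsto_slope_zero_right
    simp only [zero_add, opExp_zero, one_apply_eq_self] at hder
    filter_upwards [Metric.tendsto_nhds.1 hder (ε / 3) (by positivity), self_mem_nhdsWithin]
      with t ht ht0
    rw [Set.mem_Ioi] at ht0
    rw [dist_eq_norm] at hn ht ⊢
    have h1 : diffQuot S x t - a x = (t⁻¹ • (opExp (Y n) t x - x) - Y n x) + (Y n x - a x)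
        - t⁻¹ • (opExp (Y n) t x - S t x) := by
      rw [diffQuot, ← RCLike.real_smul_eq_coe_smul]
      module
    have h2 : ‖t⁻¹ • (opExp (Y n) t x - S t x)‖ ≤ ‖Y n x - a x‖ := by
      rw [norm_smul, norm_inv, Real.norm_of_nonneg ht0.le, inv_mul_le_iff₀ ht0]
      exact happrox t ht0.le x hx n
    rw [h1]
    have h3 := norm_sub_le ((t⁻¹ • (opExp (Y n) t x - x) - Y n x) + (Y n x - a x))
      (t⁻¹ • (opExp (Y n) t x - S t x))
    have h4 := norm_add_le (t⁻¹ • (opExp (Y n) t x - x) - Y n x) (Y n x - a x)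
    linarith
  have hcont : ∀ x ∈ s, Tendsto (fun t => S t x - x) (𝓝[>] 0) (𝓝 0) := by
    intro x hx
    have h0 : Tendsto (fun t : ℝ => t) (𝓝[>] 0) (𝓝 0) := tendsto_nhdsWithin_of_tendsto_nhds tendsto_id
    have h1 := h0.smul (hdiff x hx)
    rw [zero_smul] at h1
    refine h1.congr' ?_
    filter_upwards [self_mem_nhdsWithin] with t ht
    rw [diffQuot, ← RCLike.real_smul_eq_coe_smul, smul_inv_smul₀ (ne_of_gt ht)]
  refine ⟨S, ⟨⟨?_, ?_, ?_⟩, ?_⟩, hdiff⟩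
  · ext x
    refine tendsto_nhds_unique (hS 0 le_rfl x) ?_
    simp [opExp_zero]
  · intro t r ht hr
    ext x
    refine tendsto_nhds_unique (hS (t + r) (add_nonneg ht hr) x) ?_
    have h1 : Tendsto (fun n => opExp (Y n) t (opExp (Y n) r x - S r x)) atTop (𝓝 0) := by
      have h2 := ((hS r hr x).sub_const (S r x)).norm
      rw [sub_self, norm_zero] at h2
      exact squeeze_zero_norm (fun n => norm_opExp_apply_le (hY n) ht _) h2
    have h3 := h1.add (hS t ht (S r x))
    simp only [map_sub, sub_add_cancel, zero_add] at h3
    simpa [opExp_add] using h3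
  · intro x
    have := tendsto_apply_zero_of_dense (l := 𝓝[>] (0 : ℝ)) (L := fun t => S t - 1) (C := 2)
      (by
        filter_upwards [self_mem_nhdsWithin] with t ht y
        have h1 := norm_sub_le (S t y) y
        have h2 := hnorm t (le_of_lt ht) y
        simp only [sub_apply, one_apply_eq_self]
        linarith) hs (by simpa using hcont) x
    simpa using this.add_const x
  · intro t ht
    refine ContinuousLinearMap.opNorm_le_bound _ (Real.exp_pos _).le fun x => ?_
    simpa using hnorm t ht x

end YosidaApproximation

/-! ### Dissipative operators, resolvents and the Lumer–Phillips theorem. -/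

section LumerPhillips

variable {𝕜 H : Type*} [RCLike 𝕜] [NormedAddCommGroup H] [InnerProductSpace 𝕜 H]

theorem re_inner_ofReal_smul (l : ℝ) (x y : H) :
    RCLike.re (inner 𝕜 x ((l : 𝕜) • y)) = l * RCLike.re (inner 𝕜 x y) := by
  rw [inner_smul_right, RCLike.re_ofReal_mul]

/-- The generator of a quasicontraction semigroup with rate `ω` is dissipative up to the shift `ω`. -/
theorem re_inner_le_of_tendsto_diffQuot {ω : ℝ} {S : ℝ → H →L[𝕜] H}
    (hS : IsQuasicontractionSemigroup ω S) {x y : H}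
    (h : Tendsto (diffQuot S x) (𝓝[>] 0) (𝓝 y)) :
    RCLike.re (inner 𝕜 x y) ≤ ω * ‖x‖ ^ 2 := by
  have hlim : Tendsto (fun t => RCLike.re (inner 𝕜 x (diffQuot S x t))) (𝓝[>] 0)
      (𝓝 (RCLike.re (inner 𝕜 x y))) :=
    (RCLike.continuous_re.tendsto _).comp (tendsto_const_nhds.inner h)
  have hexp : Tendsto (fun t : ℝ => t⁻¹ * (Real.exp (ω * t) - 1) * ‖x‖ ^ 2) (𝓝[>] 0)
      (𝓝 (ω * ‖x‖ ^ 2)) := by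
    have hd : HasDerivAt (fun t => Real.exp (ω * t)) ω 0 := by
      simpa using ((hasDerivAt_id (0 : ℝ)).const_mul ω).exp
    simpa using hd.tendsto_slope_zero_right.mul_const (‖x‖ ^ 2)
  refine le_of_tendsto_of_tendsto hlim hexp ?_
  filter_upwards [self_mem_nhdsWithin] with t ht
  rw [Set.mem_Ioi] at ht
  rw [diffQuot, re_inner_ofReal_smul, mul_assoc]
  refine mul_le_mul_of_nonneg_left ?_ (inv_nonneg.2 ht.le)
  rw [inner_sub_right, map_sub, inner_self_eq_norm_sq, sub_mul, one_mul]
  refine sub_le_sub_right ?_ _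
  calc RCLike.re (inner 𝕜 x (S t x)) ≤ ‖x‖ * ‖S t x‖ := re_inner_le_norm _ _
    _ ≤ ‖x‖ * (Real.exp (ω * t) * ‖x‖) := by
      gcongr
      exact (S t).le_of_opNorm_le (hS.norm_le t ht.le) x
    _ = Real.exp (ω * t) * ‖x‖ ^ 2 := by ring

/-- An unbounded operator `A` is dissipative if `Re ⟨x, A x⟩ ≤ 0` on its domain. -/
def IsDissipative (A : H →ₗ.[𝕜] H) : Prop :=
  ∀ x : A.domain, RCLike.re (inner 𝕜 (x : H) (A x)) ≤ 0

/-- `R` is the resolvent `(l - A)⁻¹`. -/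
structure IsResolvent (A : H →ₗ.[𝕜] H) (l : ℝ) (R : H →L[𝕜] H) : Prop where
  right_inv : ∀ y, ∃ x : A.domain, (x : H) = R y ∧ (l : 𝕜) • (x : H) - A x = y
  left_inv : ∀ x : A.domain, R ((l : 𝕜) • (x : H) - A x) = x

namespace IsDissipative

variable {A : H →ₗ.[𝕜] H}

/-- Cauchy–Schwarz applied to `l ‖x‖² ≤ Re ⟨x, l x - A x⟩`. It makes `l - A` injective with inverse
bounded by `l⁻¹` when `l > 0`. -/
theorem mul_norm_le (hA : IsDissipative A) (l : ℝ) (x : A.domain) :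
    l * ‖(x : H)‖ ≤ ‖(l : 𝕜) • (x : H) - A x‖ := by
  rcases (norm_nonneg (x : H)).eq_or_lt with h | h
  · rw [← h, mul_zero]; exact norm_nonneg _
  refine le_of_mul_le_mul_left ?_ h
  have h1 := re_inner_le_norm (𝕜 := 𝕜) (x : H) ((l : 𝕜) • (x : H) - A x)
  rw [inner_sub_right, map_sub, re_inner_ofReal_smul, inner_self_eq_norm_sq] at h1
  nlinarith [hA x]

theorem exists_isResolvent (hA : IsDissipative A) {l : ℝ} (hl : 0 < l)
    (hs : ∀ y : H, ∃ x : A.domain, (l : 𝕜) • (x : H) - A x = y) :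
    ∃ R : H →L[𝕜] H, IsResolvent A l R := by
  let f : A.domain →ₗ[𝕜] H := (l : 𝕜) • A.domain.subtype - A.toFun
  have hf : ∀ x, f x = (l : 𝕜) • (x : H) - A x := fun x => rfl
  have hinj : Function.Injective f := by
    rw [injective_iff_map_eq_zero]
    intro x hx
    have h1 := hA.mul_norm_le l x
    rw [← hf, hx, norm_zero] at h1
    have h2 : ‖(x : H)‖ = 0 := le_antisymm (by nlinarith) (norm_nonneg _)
    simpa using h2
  let e := LinearEquiv.ofBijective f ⟨hinj, hs⟩
  refine ⟨(A.domain.subtype ∘ₗ (e.symm : H →ₗ[𝕜] A.domain)).mkContinuous l⁻¹ fun y => ?_,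
    fun y => ⟨e.symm y, rfl, e.apply_symm_apply y⟩, fun x => ?_⟩
  · rw [← div_eq_inv_mul, le_div_iff₀' hl]
    have := hA.mul_norm_le l (e.symm y)
    rw [← hf] at this
    exact this.trans_eq (congrArg norm (e.apply_symm_apply y))
  · exact congrArg Subtype.val (e.symm_apply_apply x)

end IsDissipative

namespace IsResolvent

variable {A : H →ₗ.[𝕜] H} {l m : ℝ} {R Q : H →L[𝕜] H}

theorem mul_norm_le (hR : IsResolvent A l R) (hA : IsDissipative A) (y : H) :
    l * ‖R y‖ ≤ ‖y‖ := by
  obtain ⟨x, hx, hxy⟩ := hR.right_inv y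
  have := hA.mul_norm_le l x
  rwa [hxy, hx] at this

/-- The resolvent identity; used in both orders, it makes resolvents commute. -/
theorem sub_apply_eq (hR : IsResolvent A l R) (hQ : IsResolvent A m Q) (y : H) :
    Q y - R y = ((l - m : ℝ) : 𝕜) • R (Q y) := by
  obtain ⟨x, hx, hxy⟩ := hQ.right_inv y
  have h := hR.left_inv x
  have h1 : (l : 𝕜) • (x : H) - A x = y + ((l - m : ℝ) : 𝕜) • (x : H) := by
    rw [← hxy]; push_cast; module
  rw [h1, map_add, map_smul, hx] at h
  exact sub_eq_of_eq_add' h.symm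

theorem commute (hR : IsResolvent A l R) (hQ : IsResolvent A m Q) : Commute R Q := by
  by_cases hlm : l = m
  · subst hlm
    have : R = Q := by
      ext y
      have := hR.sub_apply_eq hQ y
      simp only [sub_self, RCLike.ofReal_zero, zero_smul] at this
      exact (sub_eq_zero.1 this).symm
    exact this ▸ Commute.refl R
  · ext y
    have h1 := hR.sub_apply_eq hQ y
    have h2 := hQ.sub_apply_eq hR y
    have h3 : ((l - m : ℝ) : 𝕜) • R (Q y) = ((l - m : ℝ) : 𝕜) • Q (R y) := by
      rw [← h1, ← neg_sub m l, RCLike.ofReal_neg, neg_smul, ← h2, neg_sub]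
    exact smul_right_injective H (RCLike.ofReal_ne_zero.2 (sub_ne_zero.2 hlm)) h3

/-- The Yosida approximation `l (l R - 1) = l A R`. -/
noncomputable def _root_.yosidaApprox (l : ℝ) (R : H →L[𝕜] H) : H →L[𝕜] H :=
  (l : 𝕜) • ((l : 𝕜) • R - 1)

theorem commute_yosidaApprox (hR : IsResolvent A l R) (hQ : IsResolvent A m Q) :
    Commute (yosidaApprox l R) (yosidaApprox m Q) :=
  have h : Commute ((l : 𝕜) • R - 1) ((m : 𝕜) • Q - 1) :=
    (((hR.commute hQ).smul_left _).smul_right _ |>.sub_right (Commute.one_right _)).sub_left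
      (Commute.one_left _)
  (h.smul_left _).smul_right _

theorem re_inner_yosidaApprox_nonpos (hR : IsResolvent A l R) (hA : IsDissipative A)
    (hl : 0 ≤ l) (y : H) : RCLike.re (inner 𝕜 y (yosidaApprox l R y)) ≤ 0 := by
  obtain ⟨x, hx, hxy⟩ := hR.right_inv y
  have h1 : yosidaApprox l R y = (l : 𝕜) • A x := by
    simp only [yosidaApprox, smul_apply, sub_apply, one_apply_eq_self, ← hx]
    rw [← hxy]
    module
  -- Since `y = l x - A x`, this is `l Re ⟨x, A x⟩ - ‖A x‖²`.
  have h2 : RCLike.re (inner 𝕜 y (A x)) ≤ 0 := by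
    rw [← hxy, inner_sub_left, map_sub, inner_self_eq_norm_sq, inner_smul_left, RCLike.conj_ofReal,
      RCLike.re_ofReal_mul]
    nlinarith [hA x, sq_nonneg ‖A x‖]
  rw [h1, re_inner_ofReal_smul]
  exact mul_nonpos_of_nonneg_of_nonpos hl h2

theorem yosidaApprox_apply (hR : IsResolvent A l R) (x : A.domain) :
    yosidaApprox l R x = (l : 𝕜) • R (A x) := by
  have h := hR.left_inv x
  rw [map_sub, map_smul] at h
  simp only [yosidaApprox, smul_apply, sub_apply, one_apply_eq_self]
  congr 1
  rw [sub_eq_iff_eq_add] at h ⊢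
  rw [h, add_comm]

end IsResolvent

variable [CompleteSpace H] {A : H →ₗ.[𝕜] H}

/-- `m - A = (1 + (m - l) R) (l - A)`, and `Re ⟨z, R z⟩ ≥ 0` makes the first factor coercive. Every
`m ≥ l` is reached at once, without Neumann series. -/
theorem IsDissipative.surjective_of_le (hA : IsDissipative A) {l m : ℝ} (hl : 0 < l)
    (hlm : l ≤ m) (hs : ∀ y : H, ∃ x : A.domain, (l : 𝕜) • (x : H) - A x = y) (y : H) :
    ∃ x : A.domain, (m : 𝕜) • (x : H) - A x = y := by
  obtain ⟨R, hR⟩ := hA.exists_isResolvent hl hs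
  have hU : IsUnit (1 + ((m - l : ℝ) : 𝕜) • R) := by
    refine ContinuousLinearMap.isUnit_of_forall_le_norm_inner_map _ one_pos fun z => ?_
    refine le_trans ?_ (RCLike.re_le_norm _)
    obtain ⟨x, hx, hxz⟩ := hR.right_inv z
    have h1 : 0 ≤ RCLike.re (inner 𝕜 z (R z)) := by
      rw [← hx, ← hxz, inner_sub_left, map_sub, inner_smul_left, RCLike.conj_ofReal,
        RCLike.re_ofReal_mul, inner_self_eq_norm_sq, inner_re_symm]
      have := mul_nonneg hl.le (sq_nonneg ‖(x : H)‖)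
      linarith [hA x]
    rw [inner_re_symm]
    simp only [add_apply, smul_apply, one_apply_eq_self, inner_add_right, map_add,
      re_inner_ofReal_smul, inner_self_eq_norm_sq, NNReal.coe_one, mul_one]
    have := mul_nonneg (sub_nonneg.2 hlm) h1
    linarith
  obtain ⟨z, hz⟩ := (ContinuousLinearMap.isUnit_iff_bijective.1 hU).2 y
  obtain ⟨x, hx, hxz⟩ := hR.right_inv z
  refine ⟨x, ?_⟩
  simp only [add_apply, smul_apply, one_apply_eq_self, ← hx] at hz
  rw [← hz]
  rw [← hxz]
  push_cast
  module

/-- If `y = l x - A x` is orthogonal to the domain, then `0 = Re ⟨x, y⟩ ≥ l ‖x‖²`, so `x = 0` and `y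
= 0`. -/
theorem IsDissipative.dense_domain (hA : IsDissipative A) {l : ℝ} (hl : 0 < l)
    (hs : ∀ y : H, ∃ x : A.domain, (l : 𝕜) • (x : H) - A x = y) :
    Dense (A.domain : Set H) := by
  rw [Submodule.dense_iff_topologicalClosure_eq_top, Submodule.topologicalClosure_eq_top_iff,
    Submodule.eq_bot_iff]
  intro y hy
  obtain ⟨x, hx⟩ := hs y
  have h1 : inner 𝕜 (x : H) y = 0 := hy x x.2
  have h2 := congrArg RCLike.re h1
  rw [← hx, inner_sub_right, map_sub, re_inner_ofReal_smul, inner_self_eq_norm_sq, map_zero] at h2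
  have h3 : ‖(x : H)‖ ^ 2 = 0 := le_antisymm (by nlinarith [hA x]) (sq_nonneg _)
  have h4 : x = 0 := by simpa using h3
  rw [← hx, h4]
  simp

/-- The **Lumer–Phillips theorem** in a Hilbert space. -/
theorem IsDissipative.generatesQuasicontraction (hA : IsDissipative A) {l : ℝ} (hl : 0 < l)
    (hs : ∀ y : H, ∃ x : A.domain, (l : 𝕜) • (x : H) - A x = y) :
    GeneratesQuasicontraction 0 A := by
  have hpos : ∀ n : ℕ, 0 < l + n := fun n => by positivity
  choose R hR using fun n : ℕ => hA.exists_isResolvent (hpos n)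
    (hA.surjective_of_le hl (le_add_of_nonneg_right n.cast_nonneg) hs)
  have hdense := hA.dense_domain hl hs
  -- On the domain `l R x - x = R (A x)`, of norm at most `‖A x‖ / l`; density and contractivity of
  -- `l R` do the rest.
  have hJ : ∀ y, Tendsto (fun n : ℕ => (((l + n : ℝ) : 𝕜) • R n) y) atTop (𝓝 y) := by
    intro y
    have hbound : ∀ n : ℕ, ∀ z, ‖(((l + n : ℝ) : 𝕜) • R n) z‖ ≤ ‖z‖ := fun n z => by
      rw [smul_apply, norm_smul, RCLike.norm_ofReal, abs_of_pos (hpos n)]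
      exact (hR n).mul_norm_le hA z
    have key := tendsto_apply_zero_of_dense (l := atTop)
      (L := fun n : ℕ => ((l + n : ℝ) : 𝕜) • R n - 1) (C := 2)
      (Eventually.of_forall fun n z => by
        have h1 := norm_sub_le ((((l + n : ℝ) : 𝕜) • R n) z) z
        have h2 := hbound n z
        rw [sub_apply, one_apply_eq_self]
        linarith) hdense (fun x hx => by
        have h0 : Tendsto (fun n : ℕ => ‖A ⟨x, hx⟩‖ / (l + n)) atTop (𝓝 0) :=
          tendsto_const_nhds.div_atTop
            (tendsto_atTop_add_const_left _ _ tendsto_natCast_atTop_atTop)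
        refine squeeze_zero_norm (fun n => ?_) h0
        have h1 := (hR n).left_inv ⟨x, hx⟩
        rw [map_sub, map_smul] at h1
        have h2 : (((l + n : ℝ) : 𝕜) • R n - 1) x = R n (A ⟨x, hx⟩) := by
          rw [sub_apply, smul_apply, one_apply_eq_self]
          rw [sub_eq_iff_eq_add] at h1 ⊢
          rw [h1, add_comm]
        rw [h2, le_div_iff₀' (hpos n)]
        exact (hR n).mul_norm_le hA _) y
    simpa using key.add_const y
  classical
  obtain ⟨S, hS, hdiff⟩ := exists_contractionSemigroup_of_tendsto
    (Y := fun n => yosidaApprox (l + n) (R n)) (s := A.domain)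
    (a := fun x => if hx : x ∈ A.domain then A ⟨x, hx⟩ else 0)
    (fun m n => (hR m).commute_yosidaApprox (hR n))
    (fun n x => (hR n).re_inner_yosidaApprox_nonpos hA (hpos n).le x) hdense
    (fun x hx => by
      rw [SetLike.mem_coe] at hx
      simp only [hx, dif_pos]
      exact (hJ (A ⟨x, hx⟩)).congr fun n => ((hR n).yosidaApprox_apply ⟨x, hx⟩).symm)
  have hdiff' : ∀ x : A.domain, Tendsto (diffQuot S (x : H)) (𝓝[>] 0) (𝓝 (A x)) := fun x => by
    simpa using hdiff x x.2
  refine ⟨S, hS, hdiff', fun x ⟨y, hy⟩ => ?_⟩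
  -- `l - A` is onto and the generator of `S` is dissipative, so `A` has no proper extension to it.
  obtain ⟨z, hz⟩ := hs ((l : 𝕜) • x - y)
  have hw : Tendsto (diffQuot S (x - z)) (𝓝[>] 0) (𝓝 (y - A z)) :=
    (hy.sub (hdiff' z)).congr fun t => by simp only [diffQuot, map_sub]; module
  have h1 := re_inner_le_of_tendsto_diffQuot hS hw
  have h2 : y - A z = (l : 𝕜) • (x - z) := by
    rw [← sub_eq_zero, ← sub_eq_zero.2 hz]; module
  rw [h2, re_inner_ofReal_smul, inner_self_eq_norm_sq, zero_mul] at h1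
  have h3 : ‖x - z‖ ^ 2 = 0 := le_antisymm (by nlinarith) (sq_nonneg _)
  have h4 : x = z := by simpa [sub_eq_zero] using h3
  exact h4 ▸ z.2

end LumerPhillips

/-! ### Rescaling a semigroup shifts its generator and its rate. -/

section Rescaling

variable {𝕜 H : Type*} [RCLike 𝕜] [NormedAddCommGroup H] [InnerProductSpace 𝕜 H]

/-- The rescaled family `exp (c t) S t`. -/
noncomputable def expSMul (c : ℝ) (S : ℝ → H →L[𝕜] H) (t : ℝ) : H →L[𝕜] H :=
  ((Real.exp (c * t) : ℝ) : 𝕜) • S t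

theorem expSMul_neg_expSMul (c : ℝ) (S : ℝ → H →L[𝕜] H) : expSMul (-c) (expSMul c S) = S := by
  ext t x
  simp [expSMul, smul_smul, ← RCLike.ofReal_mul, ← Real.exp_add]

variable (𝕜) in
theorem tendsto_ofReal_exp_mul (c : ℝ) :
    Tendsto (fun t : ℝ => ((Real.exp (c * t) : ℝ) : 𝕜)) (𝓝[>] 0) (𝓝 1) := by
  have : Continuous fun t : ℝ => ((Real.exp (c * t) : ℝ) : 𝕜) :=
    RCLike.continuous_ofReal.comp (by fun_prop)
  simpa using (this.tendsto 0).mono_left nhdsWithin_le_nhds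

theorem tendsto_diffQuot_expSMul (c : ℝ) {S : ℝ → H →L[𝕜] H} {x y : H}
    (h : Tendsto (diffQuot S x) (𝓝[>] 0) (𝓝 y)) :
    Tendsto (diffQuot (expSMul c S) x) (𝓝[>] 0) (𝓝 (y + (c : 𝕜) • x)) := by
  have hd : HasDerivAt (fun t => Real.exp (c * t)) c 0 := by
    simpa using ((hasDerivAt_id (0 : ℝ)).const_mul c).exp
  have h2 : Tendsto (fun t : ℝ => ((t⁻¹ * (Real.exp (c * t) - 1) : ℝ) : 𝕜)) (𝓝[>] 0)
      (𝓝 (c : 𝕜)) := by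
    have : Tendsto (fun t : ℝ => t⁻¹ * (Real.exp (c * t) - 1)) (𝓝[>] 0) (𝓝 c) := by
      simpa using hd.tendsto_slope_zero_right
    exact (RCLike.continuous_ofReal (K := 𝕜)).tendsto _ |>.comp this
  have h3 := ((tendsto_ofReal_exp_mul 𝕜 c).smul h).add (h2.smul_const x)
  rw [one_smul] at h3
  refine h3.congr fun t => ?_
  simp only [diffQuot, expSMul, smul_apply]
  push_cast
  module

theorem tendsto_diffQuot_of_expSMul (c : ℝ) {S : ℝ → H →L[𝕜] H} {x y : H}
    (h : Tendsto (diffQuot (expSMul c S) x) (𝓝[>] 0) (𝓝 y)) :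
    Tendsto (diffQuot S x) (𝓝[>] 0) (𝓝 (y - (c : 𝕜) • x)) := by
  have := tendsto_diffQuot_expSMul (-c) h
  rwa [expSMul_neg_expSMul, RCLike.ofReal_neg, neg_smul, ← sub_eq_add_neg] at this

theorem IsQuasicontractionSemigroup.expSMul {ω : ℝ} {S : ℝ → H →L[𝕜] H}
    (hS : IsQuasicontractionSemigroup ω S) (c : ℝ) :
    IsQuasicontractionSemigroup (ω + c) (expSMul c S) where
  zero := by simp [_root_.expSMul, hS.zero]
  add t s ht hs := by
    ext x
    simp only [_root_.expSMul, hS.add t s ht hs, smul_apply, ContinuousLinearMap.comp_apply,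
      map_smul, smul_smul, mul_add, Real.exp_add, RCLike.ofReal_mul]
    rw [mul_comm]
  tendsto_zero x := by
    simpa [_root_.expSMul] using (tendsto_ofReal_exp_mul 𝕜 c).smul (hS.tendsto_zero x)
  norm_le t ht := by
    rw [_root_.expSMul, norm_smul, RCLike.norm_ofReal, abs_of_pos (Real.exp_pos _), add_mul,
      Real.exp_add, mul_comm]
    gcongr
    exact hS.norm_le t ht

theorem GeneratesQuasicontraction.of_shift {ω c : ℝ} {A B : H →ₗ.[𝕜] H}
    (hA : GeneratesQuasicontraction ω A) (hdom : A.domain = B.domain)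
    (hB : ∀ x (hx : x ∈ A.domain), B ⟨x, hdom ▸ hx⟩ = A ⟨x, hx⟩ + (c : 𝕜) • x) :
    GeneratesQuasicontraction (ω + c) B := by
  obtain ⟨S, hS, hgen⟩ := hA
  refine ⟨expSMul c S, hS.expSMul c, fun ⟨x, hx⟩ => ?_, fun x ⟨y, hy⟩ => ?_⟩
  · rw [hB x (hdom ▸ hx)]
    exact tendsto_diffQuot_expSMul c (hgen.tendsto ⟨x, hdom ▸ hx⟩)
  · exact hdom ▸ hgen.mem_domain x ⟨_, tendsto_diffQuot_of_expSMul c hy⟩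

end Rescaling

/-! ### Generators of negative rate are onto. -/

section StrictContraction

variable {𝕜 H : Type*} [RCLike 𝕜] [NormedAddCommGroup H] [InnerProductSpace 𝕜 H]

theorem IsQuasicontractionSemigroup.norm_apply_le {ω : ℝ} {S : ℝ → H →L[𝕜] H}
    (hS : IsQuasicontractionSemigroup ω S) (hω : ω ≤ 0) {t : ℝ} (ht : 0 ≤ t) (x : H) :
    ‖S t x‖ ≤ ‖x‖ := by
  have h1 := (S t).le_of_opNorm_le (hS.norm_le t ht) x
  have h2 : Real.exp (ω * t) ≤ 1 := Real.exp_le_one_iff.2 (mul_nonpos_of_nonpos_of_nonneg hω ht)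
  exact h1.trans (mul_le_of_le_one_left (norm_nonneg _) h2)

theorem IsQuasicontractionSemigroup.norm_apply_sub_le {ω : ℝ} {S : ℝ → H →L[𝕜] H}
    (hS : IsQuasicontractionSemigroup ω S) (hω : ω ≤ 0) {t s : ℝ} (ht : 0 ≤ t) (hs : 0 ≤ s)
    (x : H) : ‖S t x - S s x‖ ≤ ‖S |t - s| x - x‖ := by
  wlog hts : s ≤ t generalizing t s
  · rw [norm_sub_rev, abs_sub_comm]
    exact this hs ht (le_of_not_ge hts)
  rw [abs_of_nonneg (sub_nonneg.2 hts)]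
  have h := hS.add s (t - s) hs (sub_nonneg.2 hts)
  rw [add_sub_cancel] at h
  rw [h, ContinuousLinearMap.comp_apply, ← map_sub]
  exact hS.norm_apply_le hω hs _

/-- Reflecting the orbit with `|t|` makes it continuous on all of `ℝ`, so the fundamental theorem of
calculus applies at the endpoint `0`. -/
theorem IsQuasicontractionSemigroup.continuous_apply_abs {ω : ℝ} {S : ℝ → H →L[𝕜] H}
    (hS : IsQuasicontractionSemigroup ω S) (hω : ω ≤ 0) (x : H) :
    Continuous fun t : ℝ => S |t| x := by
  have h0 : Tendsto (fun t : ℝ => ‖S |t| x - x‖) (𝓝 0) (𝓝 0) := by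
    have h1 : ContinuousWithinAt (fun t => S t x) (Set.Ici 0) 0 := by
      rw [← continuousWithinAt_Ioi_iff_Ici, ContinuousWithinAt, hS.zero]
      exact hS.tendsto_zero x
    have h2 : Tendsto (fun t : ℝ => |t|) (𝓝 0) (𝓝[≥] 0) :=
      tendsto_nhdsWithin_iff.2 ⟨by simpa using (show Continuous fun t : ℝ => |t| by fun_prop).tendsto 0,
        Eventually.of_forall fun t => abs_nonneg t⟩
    have h3 := ((h1.tendsto.comp h2).sub_const x).norm
    simpa [hS.zero] using h3
  refine continuous_iff_continuousAt.2 fun t => ?_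
  rw [ContinuousAt, tendsto_iff_norm_sub_tendsto_zero]
  have h4 : Tendsto (fun s : ℝ => |s| - |t|) (𝓝 t) (𝓝 0) := by
    have : Continuous fun s : ℝ => |s| - |t| := by fun_prop
    simpa using this.tendsto t
  exact squeeze_zero (fun s => norm_nonneg _)
    (fun s => hS.norm_apply_sub_le hω (abs_nonneg s) (abs_nonneg t) x) (h0.comp h4)

variable [CompleteSpace H]

/-- The generator maps `∫₀¹ S s x ds` to `S 1 x - x`. -/
theorem IsQuasicontractionSemigroup.exists_tendsto_diffQuot_one {ω : ℝ} {S : ℝ → H →L[𝕜] H}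
    (hS : IsQuasicontractionSemigroup ω S) (hω : ω ≤ 0) (x : H) :
    ∃ y, Tendsto (diffQuot S y) (𝓝[>] 0) (𝓝 (S 1 x - x)) := by
  let _ : NormedSpace ℝ H := NormedSpace.restrictScalars ℝ 𝕜 H
  have _ : IsScalarTower ℝ 𝕜 H := RestrictScalars.isScalarTower ℝ 𝕜 H
  have hf := hS.continuous_apply_abs hω x
  set f : ℝ → H := fun t => S |t| x with hfdef
  have hint : ∀ a b, IntervalIntegrable f MeasureTheory.volume a b := fun a b => hf.intervalIntegrable a b
  have hF : ∀ t, HasDerivAt (fun u => ∫ s in (0 : ℝ)..u, f s) (f t) t := fun t =>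
    intervalIntegral.integral_hasDerivAt_right (hint _ _)
      (hf.stronglyMeasurableAtFilter _ _) hf.continuousAt
  refine ⟨∫ s in (0 : ℝ)..1, f s, ?_⟩
  -- `S t` moves the window `[0, 1]` to `[t, t + 1]`, so the integral becomes `∫₀^(t+1) f - ∫₀^t f`;
  -- this is its derivative at `t = 0`.
  have hG := ((hF (0 + 1)).comp_add_const 0 1).sub (hF 0)
  have hslope := hG.tendsto_slope_zero_right
  have hval : f (0 + 1) - f 0 = S 1 x - x := by simp [hfdef, hS.zero]
  rw [hval] at hslope
  refine hslope.congr' ?_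
  filter_upwards [self_mem_nhdsWithin] with t ht
  rw [Set.mem_Ioi] at ht
  rw [diffQuot, ← RCLike.real_smul_eq_coe_smul]
  congr 1
  have h1 : S t (∫ s in (0 : ℝ)..1, f s) = ∫ s in t..(t + 1), f s := by
    rw [← ContinuousLinearMap.intervalIntegral_comp_comm (S t) (hint 0 1)]
    have h2 : ∀ s ∈ Set.uIcc (0 : ℝ) 1, S t (f s) = f (t + s) := fun s hs => by
      rw [Set.uIcc_of_le zero_le_one] at hs
      simp only [hfdef]
      rw [abs_of_nonneg hs.1, abs_of_nonneg (add_nonneg ht.le hs.1), hS.add t s ht.le hs.1,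
        ContinuousLinearMap.comp_apply]
    rw [intervalIntegral.integral_congr h2, intervalIntegral.integral_comp_add_left, add_zero]
  rw [h1, ← intervalIntegral.integral_interval_sub_left (hint 0 (t + 1)) (hint 0 t)]
  simp

theorem IsQuasicontractionSemigroup.exists_tendsto_diffQuot {ω : ℝ} {S : ℝ → H →L[𝕜] H}
    (hS : IsQuasicontractionSemigroup ω S) (hω : ω < 0) (x : H) :
    ∃ y, Tendsto (diffQuot S y) (𝓝[>] 0) (𝓝 x) := by
  have hlt : ‖S 1‖ < 1 := (hS.norm_le 1 zero_le_one).trans_lt (by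
    rw [mul_one]; exact Real.exp_lt_one_iff.2 hω)
  obtain ⟨z, hz⟩ := (ContinuousLinearMap.isUnit_iff_bijective.1
    (isUnit_one_sub_of_norm_lt_one hlt)).2 (-x)
  obtain ⟨y, hy⟩ := hS.exists_tendsto_diffQuot_one hω.le z
  refine ⟨y, ?_⟩
  rw [sub_apply, one_apply_eq_self] at hz
  rwa [← neg_sub, hz, neg_neg] at hy

end StrictContraction

/-! ### Surjectivity through the adjoint. -/

section Adjoint

variable {𝕜 H : Type*} [RCLike 𝕜] [NormedAddCommGroup H] [InnerProductSpace 𝕜 H] [CompleteSpace H]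

/-- A bounded operator on a Hilbert space is onto iff its adjoint is bounded below. -/
theorem surjective_iff_adjoint_bounded_below (M : H →L[𝕜] H) :
    Function.Surjective M ↔ ∃ ε : ℝ, 0 < ε ∧ ∀ v, ε * ‖v‖ ≤ ‖ContinuousLinearMap.adjoint M v‖ := by
  constructor
  · intro h
    obtain ⟨C, hC, hpre⟩ := M.exists_preimage_norm_le h
    refine ⟨C⁻¹, inv_pos.2 hC, fun v => ?_⟩
    rw [inv_mul_le_iff₀ hC]
    obtain ⟨x, hx, hxv⟩ := hpre v
    rcases (norm_nonneg v).eq_or_lt with h0 | h0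
    · rw [← h0]; positivity
    refine le_of_mul_le_mul_right ?_ h0
    calc ‖v‖ * ‖v‖ = RCLike.re (inner 𝕜 v (M x)) := by
          rw [hx, inner_self_eq_norm_mul_norm]
      _ = RCLike.re (inner 𝕜 (ContinuousLinearMap.adjoint M v) x) := by
          rw [ContinuousLinearMap.adjoint_inner_left]
      _ ≤ ‖ContinuousLinearMap.adjoint M v‖ * ‖x‖ := re_inner_le_norm _ _
      _ ≤ ‖ContinuousLinearMap.adjoint M v‖ * (C * ‖v‖) := by gcongr
      _ = C * ‖ContinuousLinearMap.adjoint M v‖ * ‖v‖ := by ring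
  · rintro ⟨ε, hε, h⟩ y
    have hU : IsUnit (M * ContinuousLinearMap.adjoint M) := by
      refine ContinuousLinearMap.isUnit_of_forall_le_norm_inner_map _
        (c := ⟨ε ^ 2, sq_nonneg ε⟩) (NNReal.coe_pos.1 (pow_pos hε 2)) fun v => ?_
      refine le_trans ?_ (RCLike.re_le_norm _)
      change ‖v‖ ^ 2 * ε ^ 2 ≤ _
      rw [mul_apply_eq_comp, ← ContinuousLinearMap.adjoint_inner_right, inner_self_eq_norm_sq,
        ← mul_pow, mul_comm]
      exact pow_le_pow_left₀ (by positivity) (h v) 2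
    obtain ⟨z, hz⟩ := (ContinuousLinearMap.isUnit_iff_bijective.1 hU).2 y
    exact ⟨_, hz⟩

end Adjoint

/-! ### The operator `𝒜 ∘ T⁻¹` and the main theorem. -/

section CompInverse

variable {𝕜 H : Type*} [RCLike 𝕜] [NormedAddCommGroup H] [InnerProductSpace 𝕜 H]

theorem compInverse_apply {D : Submodule 𝕜 H} (T : H →L[𝕜] D) (hT : Function.Bijective T)
    (𝒜 : H →L[𝕜] H) (v : H) : compInverse T hT 𝒜 (T v) = 𝒜 v :=
  congrArg 𝒜 ((LinearEquiv.ofBijective (T : H →ₗ[𝕜] D) hT).symm_apply_apply v)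

end CompInverse

theorem mainTheorem1 {𝕜 H : Type*} [RCLike 𝕜] [NormedAddCommGroup H] [InnerProductSpace 𝕜 H]
    [CompleteSpace H] (D : Submodule 𝕜 H) (T : H →L[𝕜] D) (hT : Function.Bijective T)
    (𝒜 : H →L[𝕜] H) (ω : ℝ) :
    GeneratesQuasicontraction ω (compInverse T hT 𝒜) ↔
      (∀ v : H, RCLike.re (inner 𝕜 (T v : H) (𝒜 v)) ≤
          ω * RCLike.re (inner 𝕜 (T v : H) (T v : H))) ∧
      (∃ ε l : ℝ, 0 < ε ∧ ω < l ∧ ∀ v : H,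
          ε * ‖v‖ ≤ ‖((l : 𝕜) • ContinuousLinearMap.adjoint (D.subtypeL ∘L T) -
            ContinuousLinearMap.adjoint 𝒜) v‖) := by
  have hadj : ∀ l : ℝ, (l : 𝕜) • ContinuousLinearMap.adjoint (D.subtypeL ∘L T) -
      ContinuousLinearMap.adjoint 𝒜
        = ContinuousLinearMap.adjoint ((l : 𝕜) • (D.subtypeL ∘L T) - 𝒜) := fun l => by
    rw [map_sub, map_smulₛₗ, RCLike.conj_ofReal]
  constructor
  · rintro ⟨S, hS, hgen⟩
    refine ⟨fun v => ?_, ?_⟩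
    · have := re_inner_le_of_tendsto_diffQuot hS (hgen.tendsto (T v))
      rwa [compInverse_apply, ← inner_self_eq_norm_sq (𝕜 := 𝕜)] at this
    -- With `l = ω + 1` the rescaled semigroup has rate `-1`, so its generator `A - l` is onto.
    · have hsurj : Function.Surjective (((ω + 1 : ℝ) : 𝕜) • (D.subtypeL ∘L T) - 𝒜) := by
        intro y
        obtain ⟨x, hx⟩ := (hS.expSMul (-(ω + 1))).exists_tendsto_diffQuot (by linarith) (-y)
        have hx' := tendsto_diffQuot_of_expSMul _ hx
        obtain ⟨v, hv⟩ := hT.2 ⟨x, hgen.mem_domain x ⟨_, hx'⟩⟩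
        have hxv : x = T v := by rw [hv]
        have h1 := hgen.tendsto (T v)
        rw [compInverse_apply, ← hxv] at h1
        have h2 := tendsto_nhds_unique h1 hx'
        refine ⟨v, ?_⟩
        simp only [sub_apply, smul_apply, ContinuousLinearMap.comp_apply, Submodule.subtypeL_apply,
          h2, ← hxv]
        push_cast
        module
      obtain ⟨ε, hε, h⟩ := (surjective_iff_adjoint_bounded_below _).1 hsurj
      exact ⟨ε, ω + 1, hε, lt_add_one ω, fun v => hadj (ω + 1) ▸ h v⟩
  · rintro ⟨hdiss, ε, l, hε, hl, h⟩
    have hsurj := (surjective_iff_adjoint_bounded_below _).2 ⟨ε, hε, fun v => hadj l ▸ h v⟩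
    -- This is `𝒜 ∘ T⁻¹ - ω`; its range condition is at `l - ω > 0`.
    let A := compInverse T hT (𝒜 - (ω : 𝕜) • (D.subtypeL ∘L T))
    have hval : ∀ v, A (T v) = 𝒜 v - (ω : 𝕜) • (T v : H) := fun v => compInverse_apply T hT _ v
    have hA : IsDissipative A := fun x => by
      obtain ⟨v, rfl⟩ := hT.2 x
      rw [hval, inner_sub_right, map_sub, re_inner_ofReal_smul]
      exact sub_nonpos.2 (hdiss v)
    have hgen := hA.generatesQuasicontraction (sub_pos.2 hl) fun y => by
      obtain ⟨v, hv⟩ := hsurj y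
      refine ⟨T v, ?_⟩
      rw [hval, ← hv]
      simp only [sub_apply, smul_apply, ContinuousLinearMap.comp_apply, Submodule.subtypeL_apply]
      push_cast
      module
    rw [← zero_add ω]
    refine hgen.of_shift rfl fun x hx => ?_
    obtain ⟨v, hv⟩ := hT.2 ⟨x, hx⟩
    have hxv : x = T v := by rw [hv]
    subst hxv
    exact (compInverse_apply T hT 𝒜 v).trans (eq_add_of_sub_eq (hval v).symm)
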